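/- Let $V$ be a complex vector space of countably infinite dimension, in one of three situations: (A) a countable-dimensional subspace $V_*\subset V^*=\operatorname{Hom}(V,\mathbb C)$ is fixed such that the pairing $V_*\times V\to\mathbb C$ is nondegenerate; (BD) $V$ carries a nondegenerate symmetric bilinear form $\omega$; (C) $V$ carries a nondegenerate alternating (symplectic) bilinear form $\omega$. In cases (BD) and (C) put $V_*=\{\omega(v,\cdot):v\in V\}$. Let $GL(\infty)$ be the group of all $g\in GL(V)$ such that $g(V_*)=V_*$ and $g$ fixes pointwise a finite-codimensional subspace of $V$ and a finite-codimensional subspace of $V_*$. Let $G$ be $GL(\infty)$ in case (A), and the subgroup $O(\infty)$, respectively $Sp(\infty)$, of all $g\in GL(\infty)$ preserving $\omega$ in cases (BD), respectively (C). A basis $E$ of $V$ is admissible if, in case (A), the dual family $\{\phi_e\}_{e\in E}$ spans $V_*$, and, in cases (BD) and (C), there is an involution $i_E:E\to E$ with at most one fixed point such that $\omega(e,e')\neq0$ if and only if $e'=i_E(e)$. For a finite subset $S\subset E$ (stable under $i_E$ in cases (BD), (C)) let $G(S)=G\cap GL(\langle S\rangle)$, where $GL(\langle S\rangle)$ is viewed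 as the group of those $g\in GL(V)$ that map $\langle S\rangle$ onto itself and fix every element of $E\setminus S$. A subgroup of $G(S)$ is called parabolic if it is the stabilizer in $G(S)$ of a flag of subspaces of $\langle S\rangle$, the flag being isotropic, i.e. stable under $F\mapsto F^\perp$ (orthogonal in $\langle S\rangle$), in cases (BD) and (C). A subgroup $P\subset G$ is a splitting parabolic subgroup if there is an admissible basis $E=\bigcup_{n\ge1}E_n$, with $E_1\subset E_2\subset\cdots$ finite (and $i_E$-stable in cases (BD), (C)), such that $P$ contains the group $H(E)$ of all elements of $G$ that are diagonal in the basis $E$, and $P\cap G(E_n)$ is a parabolic subgroup of $G(E_n)$ for all $n$. Theorem. Let $\ell\ge4$ and let $P_1,\dots,P_\ell\subsetneq G$ be proper splitting parabolic subgroups. Then $G$ has infinitely many orbits in its diagonal action on $G/P_1\times\cdots\times G/P_\ell$. -/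

import Mathlib

/-- The three types of data on a complex vector space `V` that define a classical ind-group:
type (A): a countable-dimensional space `Vs` of linear forms on `V` whose pairing with `V` is
nondegenerate; type (BD): a nondegenerate symmetric bilinear form; type (C): a nondegenerate
alternating (symplectic) bilinear form. -/
inductive ClassicalType (V : Type*) [AddCommGroup V] [Module ℂ V] where
  | typeA (Vs : Submodule ℂ (Module.Dual ℂ V))
      (countable_dim : Module.rank ℂ Vs = Cardinal.aleph0)
      (nondegenerate : ∀ v : V, (∀ φ ∈ Vs, φ v = 0) → v = 0)
  | typeBD (ω : LinearMap.BilinForm ℂ V) (symm : ω.IsSymm) (nondegenerate : ω.Nondegenerate)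
  | typeC (ω : LinearMap.BilinForm ℂ V) (alt : ω.IsAlt) (nondegenerate : ω.Nondegenerate)

namespace ClassicalType

variable {V : Type*} [AddCommGroup V] [Module ℂ V]

/-- The subspace `V_*` of the dual space: the given one in type (A), and the space of all forms
`ω(v, ·)` in types (BD) and (C). -/
def dualSpace : ClassicalType V → Submodule ℂ (Module.Dual ℂ V)
  | typeA Vs _ _ => Vs
  | typeBD ω _ _ => LinearMap.range ω
  | typeC ω _ _ => LinearMap.range ω

/-- `g` preserves the bilinear form (no condition in type (A)). -/
def PreservesForm (t : ClassicalType V) (g : V ≃ₗ[ℂ] V) : Prop :=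
  match t with
  | typeA _ _ _ => True
  | typeBD ω _ _ => ∀ x y, ω (g x) (g y) = ω x y
  | typeC ω _ _ => ∀ x y, ω (g x) (g y) = ω x y

/-- The group `GL(∞)` attached to `V` and `V_* = Vs`: all `g ∈ GL(V)` with `g(V_*) = V_*` that fix
pointwise a finite-codimensional subspace of `V` and a finite-codimensional subspace of `V_*`.
Here `g` acts on linear forms by `φ ↦ φ ∘ g⁻¹`. -/
def finitaryGL (Vs : Submodule ℂ (Module.Dual ℂ V)) : Subgroup (V ≃ₗ[ℂ] V) where
  carrier := {g |
    (∀ φ : Module.Dual ℂ V, φ ∘ₗ (g : V →ₗ[ℂ] V) ∈ Vs ↔ φ ∈ Vs) ∧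
    (∃ W : Submodule ℂ V, FiniteDimensional ℂ (V ⧸ W) ∧ ∀ w ∈ W, g w = w) ∧
    (∃ W : Submodule ℂ Vs, FiniteDimensional ℂ (Vs ⧸ W) ∧
      ∀ φ ∈ W, (φ : Module.Dual ℂ V) ∘ₗ (g : V →ₗ[ℂ] V) = φ)}
  one_mem' := by
    refine ⟨fun φ => Iff.rfl, ⟨⊤, inferInstance, fun _ _ => rfl⟩, ⟨⊤, inferInstance, fun _ _ => rfl⟩⟩
  mul_mem' := by
    rintro g h ⟨hg, ⟨W, hW, hgW⟩, ⟨X, hX, hgX⟩⟩ ⟨hh, ⟨W', hW', hhW⟩, ⟨X', hX', hhX⟩⟩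
    refine ⟨fun φ => ?_, ⟨W ⊓ W', ?_, fun w hw => ?_⟩, ⟨X ⊓ X', ?_, fun φ hφ => ?_⟩⟩
    · rw [← hg φ, ← hh (φ ∘ₗ (g : V →ₗ[ℂ] V))]
      rfl
    · exact Submodule.CoFG.inf hW hW'
    · change g (h w) = w
      rw [hhW w hw.2, hgW w hw.1]
    · exact Submodule.CoFG.inf hX hX'
    · change ((φ : Module.Dual ℂ V) ∘ₗ (g : V →ₗ[ℂ] V)) ∘ₗ (h : V →ₗ[ℂ] V) = φ
      rw [hgX φ hφ.1, hhX φ hφ.2]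
  inv_mem' := by
    rintro g ⟨hg, ⟨W, hW, hgW⟩, ⟨X, hX, hgX⟩⟩
    have key : ∀ φ : Module.Dual ℂ V,
        (φ ∘ₗ ((g⁻¹ : V ≃ₗ[ℂ] V) : V →ₗ[ℂ] V)) ∘ₗ (g : V →ₗ[ℂ] V) = φ := by
      intro φ
      ext v
      change φ (g.symm (g v)) = φ v
      rw [g.symm_apply_apply]
    refine ⟨fun φ => ?_, ⟨W, hW, fun w hw => ?_⟩, ⟨X, hX, fun φ hφ => ?_⟩⟩
    · rw [← hg, key]
    · change g.symm w = w
      rw [LinearEquiv.symm_apply_eq, hgW w hw]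
    · conv_lhs => rw [← hgX φ hφ]
      ext v
      change (φ : Module.Dual ℂ V) (g (g.symm v)) = _
      rw [g.apply_symm_apply]

/-- The subgroup of `GL(V)` of all elements that preserve the bilinear form. -/
def isometries (t : ClassicalType V) : Subgroup (V ≃ₗ[ℂ] V) where
  carrier := {g | t.PreservesForm g}
  one_mem' := by cases t <;> simp [PreservesForm]
  mul_mem' := by
    intro g h hg hh
    cases t <;> simp_all [PreservesForm]
  inv_mem' := by
    intro g hg
    have key : ∀ x, g ((g⁻¹ : V ≃ₗ[ℂ] V) x) = x := g.apply_symm_apply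
    cases t with
    | typeA Vs h1 h2 => trivial
    | typeBD ω h1 h2 => exact fun x y => by rw [← hg, key, key]
    | typeC ω h1 h2 => exact fun x y => by rw [← hg, key, key]

/-- The classical ind-group `GL(∞)`, `O(∞)` or `Sp(∞)`, according to the type. -/
def indGroup (t : ClassicalType V) : Subgroup (V ≃ₗ[ℂ] V) :=
  finitaryGL t.dualSpace ⊓ t.isometries

/-- `E` is a basis that carries an involution `σ` with at most one fixed point such that
`ω(e, e') ≠ 0` if and only if `e' = σ e`. -/
def HasInvolution (ω : LinearMap.BilinForm ℂ V) (E : Module.Basis ℕ ℂ V) : Prop :=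
  ∃ σ : ℕ → ℕ, Function.Involutive σ ∧ (∀ i j, σ i = i → σ j = j → i = j) ∧
    ∀ i j, ω (E i) (E j) ≠ 0 ↔ j = σ i

/-- Admissible bases. In type (A) the dual family has to span `V_*`. (Since `V` has countably
infinite dimension, its bases can be indexed by `ℕ`.) -/
def IsAdmissible (t : ClassicalType V) (E : Module.Basis ℕ ℂ V) : Prop :=
  match t with
  | typeA Vs _ _ => Submodule.span ℂ (Set.range E.coord) = Vs
  | typeBD ω _ _ => HasInvolution ω E
  | typeC ω _ _ => HasInvolution ω E

/-- The finite subset `S` of the basis `E` is stable under the involution of `E` (no condition in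
type (A)): with `e` it contains the unique `e'` with `ω(e, e') ≠ 0`. -/
def IsStable (t : ClassicalType V) (E : Module.Basis ℕ ℂ V) (S : Finset ℕ) : Prop :=
  match t with
  | typeA _ _ _ => True
  | typeBD ω _ _ => ∀ i ∈ S, ∀ j, ω (E i) (E j) ≠ 0 → j ∈ S
  | typeC ω _ _ => ∀ i ∈ S, ∀ j, ω (E i) (E j) ≠ 0 → j ∈ S

/-- The exhaustion `E = ⋃ E_n` of a basis by an increasing sequence of finite subsets, stable under
the involution of `E` in types (BD) and (C). -/
def IsFiltration (t : ClassicalType V) (E : Module.Basis ℕ ℂ V) (En : ℕ → Finset ℕ) : Prop :=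
  Monotone En ∧ (∀ i, ∃ n, i ∈ En n) ∧ ∀ n, t.IsStable E (En n)

/-- The span `⟨S⟩` of a finite subset `S` of the basis `E`. -/
def spanOf (E : Module.Basis ℕ ℂ V) (S : Finset ℕ) : Submodule ℂ V :=
  Submodule.span ℂ (E '' (S : Set ℕ))

/-- The group `GL(⟨S⟩)` as a subgroup of `GL(V)`: its elements map `⟨S⟩` onto itself and fix all
basis vectors outside `S`. -/
def glOf (E : Module.Basis ℕ ℂ V) (S : Finset ℕ) : Subgroup (V ≃ₗ[ℂ] V) where
  carrier := {g | (spanOf E S).map (g : V →ₗ[ℂ] V) = spanOf E S ∧ ∀ i ∉ S, g (E i) = E i}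
  one_mem' := ⟨Submodule.map_id _, fun _ _ => rfl⟩
  mul_mem' := by
    rintro g h ⟨hg, hg'⟩ ⟨hh, hh'⟩
    refine ⟨?_, fun i hi => ?_⟩
    · change (spanOf E S).map ((g : V →ₗ[ℂ] V) ∘ₗ (h : V →ₗ[ℂ] V)) = _
      rw [Submodule.map_comp, hh, hg]
    · change g (h (E i)) = E i
      rw [hh' i hi, hg' i hi]
  inv_mem' := by
    rintro g ⟨hg, hg'⟩
    refine ⟨?_, fun i hi => ?_⟩
    · conv_lhs => rw [← hg]
      rw [← Submodule.map_comp]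
      have : ((g⁻¹ : V ≃ₗ[ℂ] V) : V →ₗ[ℂ] V) ∘ₗ (g : V →ₗ[ℂ] V) = LinearMap.id := by
        ext v
        exact g.symm_apply_apply v
      rw [this, Submodule.map_id]
    · change g.symm (E i) = E i
      rw [LinearEquiv.symm_apply_eq, hg' i hi]

/-- The finite-dimensional classical group `G(S) = G ∩ GL(⟨S⟩)`. -/
def finGroup (t : ClassicalType V) (E : Module.Basis ℕ ℂ V) (S : Finset ℕ) :
    Subgroup t.indGroup :=
  (glOf E S).subgroupOf t.indGroup

/-- The splitting Cartan subgroup `H(E)`: the elements of `G` that are diagonal in the basis `E`. -/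
def cartan (t : ClassicalType V) (E : Module.Basis ℕ ℂ V) : Subgroup t.indGroup where
  carrier := {g | ∀ i, ∃ c : ℂ, (g : V ≃ₗ[ℂ] V) (E i) = c • E i}
  one_mem' := fun i => ⟨1, by simp⟩
  mul_mem' := by
    intro g h hg hh i
    obtain ⟨c, hc⟩ := hg i
    obtain ⟨d, hd⟩ := hh i
    refine ⟨d * c, ?_⟩
    change (g : V ≃ₗ[ℂ] V) ((h : V ≃ₗ[ℂ] V) (E i)) = _
    rw [hd, map_smul, hc, smul_smul]
  inv_mem' := by
    intro g hg i
    obtain ⟨c, hc⟩ := hg i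
    have hc0 : c ≠ 0 := by
      rintro rfl
      rw [zero_smul, LinearEquiv.map_eq_zero_iff] at hc
      exact E.ne_zero i hc
    refine ⟨c⁻¹, ?_⟩
    change (g : V ≃ₗ[ℂ] V).symm (E i) = _
    rw [LinearEquiv.symm_apply_eq, map_smul, hc, smul_smul, inv_mul_cancel₀ hc0, one_smul]

/-- `𝓕` is a flag of subspaces of `U`; in types (BD) and (C) it is moreover isotropic, that is,
stable under taking orthogonal spaces in `U`. -/
def IsFlagIn (t : ClassicalType V) (U : Submodule ℂ V) (𝓕 : Set (Submodule ℂ V)) : Prop :=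
  ⊥ ∈ 𝓕 ∧ U ∈ 𝓕 ∧ (∀ F ∈ 𝓕, F ≤ U) ∧ IsChain (· ≤ ·) 𝓕 ∧
  match t with
  | typeA _ _ _ => True
  | typeBD ω _ _ => ∀ F ∈ 𝓕, U ⊓ ω.orthogonal F ∈ 𝓕
  | typeC ω _ _ => ∀ F ∈ 𝓕, U ⊓ ω.orthogonal F ∈ 𝓕

/-- `Q` is a parabolic subgroup of the classical group `G(S)`, that is, the stabilizer in `G(S)` of
a flag of subspaces of `⟨S⟩` (isotropic in types (BD) and (C)). For the disconnected group `O(S)`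
this excludes the subgroup `SO(S)`. -/
def IsParabolicIn (t : ClassicalType V) (E : Module.Basis ℕ ℂ V) (S : Finset ℕ)
    (Q : Subgroup t.indGroup) : Prop :=
  ∃ 𝓕 : Set (Submodule ℂ V), t.IsFlagIn (spanOf E S) 𝓕 ∧
    ∀ g : t.indGroup, g ∈ Q ↔
      g ∈ t.finGroup E S ∧ ∀ F ∈ 𝓕, F.map ((g : V ≃ₗ[ℂ] V) : V →ₗ[ℂ] V) = F

/-- `P` is a splitting parabolic subgroup of `G`: for some admissible basis `E`, exhausted by finite
subsets `E_n`, it contains `H(E)`, and each `P ∩ G(E_n)` is a parabolic subgroup of `G(E_n)`. -/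
def IsSplittingParabolic (t : ClassicalType V) (P : Subgroup t.indGroup) : Prop :=
  ∃ (E : Module.Basis ℕ ℂ V) (En : ℕ → Finset ℕ), t.IsAdmissible E ∧ t.IsFiltration E En ∧
    t.cartan E ≤ P ∧ ∀ n, t.IsParabolicIn E (En n) (P ⊓ t.finGroup E (En n))

end ClassicalType

namespace ClassicalType

variable {V : Type*} [AddCommGroup V] [Module ℂ V]

/-! ### Configurations of four points and the counting argument -/

theorem infinite_orbits_of_transporters (hV : Module.rank ℂ V = Cardinal.aleph0)
    (t : ClassicalType V) {l : ℕ} (hl : 4 ≤ l) (P : Fin l → Subgroup t.indGroup)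
    (F : Fin l → Submodule ℂ V)
    (hF : ∀ i, ∀ p ∈ P i, ∀ x ∈ F i, (p : V ≃ₗ[ℂ] V) x ∈ F i)
    (a b : V) (α β : Module.Dual ℂ V)
    (haa : α a = 1)
    (H : ∀ i (s : ℂ), ∃ g : t.indGroup, (∃ x ∈ F i, (g : V ≃ₗ[ℂ] V) x = a + s • b) ∧
      ∀ x ∈ F i, β ((g : V ≃ₗ[ℂ] V) x) = s * α ((g : V ≃ₗ[ℂ] V) x)) :
    Infinite (MulAction.orbitRel.Quotient t.indGroup (∀ i, t.indGroup ⧸ P i)) := by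
  choose g hg hg' using H
  let s : Fin l → ℂ → ℂ := fun i z => if i.val = 0 then 0 else if i.val = 1 then 1 else
    if i.val = 2 then 2 else z
  let T : ℂ → ∀ i, t.indGroup ⧸ P i := fun z i => (g i (s i z) : t.indGroup ⧸ P i)
  rw [← not_finite_iff_infinite]
  intro hfin
  let f : ℂ → MulAction.orbitRel.Quotient t.indGroup (∀ i, t.indGroup ⧸ P i) := fun z =>
    Quotient.mk _ (T z)
  obtain ⟨q, hq⟩ : ∃ q, ¬ (f ⁻¹' {q}).Countable := by
    by_contra! hcon
    apply not_countable_complex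
    have : (Set.univ : Set ℂ) = ⋃ q, f ⁻¹' {q} := by
      ext z; simp
    rw [this]
    exact Set.countable_iUnion hcon
  obtain ⟨z₀, hz₀⟩ : (f ⁻¹' {q}).Nonempty := by
    rw [Set.nonempty_iff_ne_empty]
    rintro h
    exact hq (h ▸ Set.countable_empty)
  have hk : ∀ z : f ⁻¹' {q}, ∃ k : t.indGroup, k • T z₀ = T z := by
    intro z
    have h1 : f z = f z₀ := by
      rw [Set.mem_preimage, Set.mem_singleton_iff] at hz₀
      rw [hz₀]; exact z.2
    exact Quotient.exact h1
  choose k hk using hk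
  have hp : ∀ z : f ⁻¹' {q}, ∀ i, (g i (s i z))⁻¹ * (k z * g i (s i z₀)) ∈ P i := by
    intro z i
    rw [← QuotientGroup.eq]
    exact (congrFun (hk z) i).symm
  -- `k w * (k z)⁻¹` carries the `i`-th translate at `z` to the one at `w`: the former contains `a +
  -- s i z • b`, the latter lies in the kernel of `β - s i w • α`.
  have key : ∀ (z w : f ⁻¹' {q}) (i : Fin l),
      β ((k w : V ≃ₗ[ℂ] V) ((k z : V ≃ₗ[ℂ] V).symm (a + s i z • b))) =
        s i w * α ((k w : V ≃ₗ[ℂ] V) ((k z : V ≃ₗ[ℂ] V).symm (a + s i z • b))) := by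
    intro z w i
    obtain ⟨x, hx, hxe⟩ := hg i (s i z)
    have h1 := hF i _ ((P i).inv_mem (hp z i)) x hx
    have h2 := hF i _ (hp w i) _ h1
    have h3 := hg' i (s i w) _ h2
    have h4 : ((g i (s i w) : t.indGroup) : V ≃ₗ[ℂ] V)
        ((((g i (s i w))⁻¹ * (k w * g i (s i z₀)) : t.indGroup) : V ≃ₗ[ℂ] V)
        (((((g i (s i z))⁻¹ * (k z * g i (s i z₀)))⁻¹ : t.indGroup) : V ≃ₗ[ℂ] V) x)) =
        (k w : V ≃ₗ[ℂ] V) ((k z : V ≃ₗ[ℂ] V).symm (a + s i z • b)) := by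
      rw [← hxe]
      simp only [← LinearEquiv.mul_apply, ← Subgroup.coe_mul]
      have : g i (s i w) * ((g i (s i w))⁻¹ * (k w * g i (s i z₀)) *
          ((g i (s i z))⁻¹ * (k z * g i (s i z₀)))⁻¹) = k w * ((k z)⁻¹ * g i (s i z)) := by
        group
      rw [this]
      rfl
    rwa [h4] at h3
  have hli : LinearIndependent ℂ (fun z : f ⁻¹' {q} => (k z : V ≃ₗ[ℂ] V).symm a) := by
    refine LinearIndependent.of_pairwise_dual_eq_zero_one _
      (fun w => α ∘ₗ ((k w : V ≃ₗ[ℂ] V) : V →ₗ[ℂ] V)) ?_ ?_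
    · intro w z hwz
      have e0 := key z w ⟨0, by omega⟩
      have e1 := key z w ⟨1, by omega⟩
      have e2 := key z w ⟨2, by omega⟩
      have e3 := key z w ⟨3, by omega⟩
      simp only [s, map_add, map_smul, smul_eq_mul] at e0 e1 e2 e3
      norm_num at e0 e1 e2 e3
      change α ((k w : V ≃ₗ[ℂ] V) ((k z : V ≃ₗ[ℂ] V).symm a)) = 0
      have hwz' : (w : ℂ) - z ≠ 0 := sub_ne_zero.2 fun h => hwz (Subtype.ext h)
      rw [e0] at e1 e2 e3
      refine (mul_eq_zero.1 (?_ : ((w : ℂ) - z) * _ = 0)).resolve_left hwz'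
      -- The points 0, 1, 2 make the matrix scalar; then `e3` says that `z` and `w` times the scalar
      -- agree.
      have e4 : α ((k w : V ≃ₗ[ℂ] V) ((k z : V ≃ₗ[ℂ] V).symm b)) = 0 := by
        linear_combination e1 - (1 / 2) * e2
      rw [e4] at e1 e3
      linear_combination z * e1 - e3
    · intro z
      simp [haa]
  have hc := hli.cardinal_lift_le_rank
  rw [hV, Cardinal.lift_aleph0, Cardinal.lift_le_aleph0, Cardinal.mk_le_aleph0_iff] at hc
  exact hq hc

/-! ### Finitary elements and admissible bases -/

/-- `ω` is the bilinear form that defines `t`, a datum of type (BD) or (C). -/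
structure HasForm (t : ClassicalType V) (ω : LinearMap.BilinForm ℂ V) : Prop where
  dualSpace_eq : t.dualSpace = LinearMap.range ω
  mem_isometries_iff : ∀ g, g ∈ t.isometries ↔ ∀ x y, ω (g x) (g y) = ω x y
  hasInvolution : ∀ E, t.IsAdmissible E → HasInvolution ω E
  mem_of_isStable : ∀ E S, t.IsStable E S → ∀ i ∈ S, ∀ j, ω (E i) (E j) ≠ 0 → j ∈ S
  orthogonal_mem : ∀ U 𝓕, t.IsFlagIn U 𝓕 → ∀ F ∈ 𝓕, U ⊓ ω.orthogonal F ∈ 𝓕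
  isRefl : ω.IsRefl
  nondegenerate : ω.Nondegenerate

theorem hasForm_typeBD (ω : LinearMap.BilinForm ℂ V) (symm : ω.IsSymm) (nd : ω.Nondegenerate) :
    (typeBD ω symm nd).HasForm ω where
  dualSpace_eq := rfl
  mem_isometries_iff _ := Iff.rfl
  hasInvolution _ h := h
  mem_of_isStable _ _ h := h
  orthogonal_mem _ _ h := h.2.2.2.2
  isRefl := symm.isRefl
  nondegenerate := nd

theorem hasForm_typeC (ω : LinearMap.BilinForm ℂ V) (alt : ω.IsAlt) (nd : ω.Nondegenerate) :
    (typeC ω alt nd).HasForm ω where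
  dualSpace_eq := rfl
  mem_isometries_iff _ := Iff.rfl
  hasInvolution _ h := h
  mem_of_isStable _ _ h := h
  orthogonal_mem _ _ h := h.2.2.2.2
  isRefl := alt.isRefl
  nondegenerate := nd

theorem dilatransvection_mem_finitaryGL {Vs : Submodule ℂ (Module.Dual ℂ V)}
    {ξ : Module.Dual ℂ V} {u : V} (h : IsUnit (1 + ξ u)) (hξ : ξ ∈ Vs) :
    LinearEquiv.dilatransvection h ∈ finitaryGL Vs := by
  have key : ∀ φ : Module.Dual ℂ V,
      φ ∘ₗ (LinearEquiv.dilatransvection h : V →ₗ[ℂ] V) = φ + φ u • ξ := by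
    intro φ
    ext x
    change φ (LinearEquiv.dilatransvection h x) = φ x + φ u * ξ x
    rw [LinearEquiv.dilatransvection.apply, map_add, map_smul, smul_eq_mul, mul_comm]
  refine ⟨fun φ => ?_, ⟨LinearMap.ker ξ, Submodule.CoFG.ker ξ, fun w hw => ?_⟩,
    ⟨LinearMap.ker (Module.Dual.eval ℂ V u ∘ₗ Vs.subtype), Submodule.CoFG.ker _,
      fun φ hφ => ?_⟩⟩
  · rw [key, Submodule.add_mem_iff_left _ (Vs.smul_mem _ hξ)]
  · rw [LinearEquiv.dilatransvection.apply, LinearMap.mem_ker.1 hw, zero_smul, add_zero]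
  · have : (φ : Module.Dual ℂ V) u = 0 := hφ
    rw [key, this, zero_smul, add_zero]

theorem eq_zero_of_forall_dualSpace (t : ClassicalType V) {v : V}
    (hv : ∀ φ ∈ t.dualSpace, φ v = 0) : v = 0 := by
  cases t with
  | typeA Vs h1 h2 => exact h2 v hv
  | typeBD ω h1 h2 => exact h2.2 v fun x => hv _ ⟨x, rfl⟩
  | typeC ω h1 h2 => exact h2.2 v fun x => hv _ ⟨x, rfl⟩

theorem HasInvolution.finite_support {ω : LinearMap.BilinForm ℂ V} {E : Module.Basis ℕ ℂ V}
    (h : HasInvolution ω E) (v : V) : {i | ω v (E i) ≠ 0}.Finite := by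
  obtain ⟨σ, -, -, hσ⟩ := h
  refine ((E.repr v).support.finite_toSet.image σ).subset fun i hi => ?_
  by_contra hcon
  apply hi
  rw [← E.linearCombination_repr v, Finsupp.linearCombination_apply, Finsupp.sum, map_sum,
    LinearMap.sum_apply]
  refine Finset.sum_eq_zero fun j hj => ?_
  rw [map_smul, LinearMap.smul_apply]
  have : ω (E j) (E i) = 0 := by
    by_contra hne
    exact hcon ⟨j, hj, ((hσ j i).1 hne).symm⟩
  rw [this, smul_zero]

theorem finite_support_of_mem_dualSpace {t : ClassicalType V} {E : Module.Basis ℕ ℂ V}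
    (hE : t.IsAdmissible E) {φ : Module.Dual ℂ V} (hφ : φ ∈ t.dualSpace) :
    {i | φ (E i) ≠ 0}.Finite := by
  cases t with
  | typeA Vs h1 h2 =>
    have h : Submodule.span ℂ (Set.range E.coord) = Vs := hE
    change φ ∈ Vs at hφ
    rw [← h] at hφ
    induction hφ using Submodule.span_induction with
    | mem x hx =>
      obtain ⟨j, rfl⟩ := hx
      refine (Set.finite_singleton j).subset fun i hi => ?_
      by_contra hij
      exact hi (by simp [Module.Basis.coord_apply, show i ≠ j from hij])
    | zero => simp
    | add x y _ _ hx hy =>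
      refine (hx.union hy).subset fun i hi => ?_
      by_contra hcon
      simp only [Set.mem_union, Set.mem_ofPred_eq, not_or, not_not] at hcon
      exact hi (by simp [hcon.1, hcon.2])
    | smul c x _ hx =>
      refine hx.subset fun i hi hcon => hi ?_
      simp [hcon]
  | typeBD ω h1 h2 =>
    obtain ⟨v, rfl⟩ := hφ
    exact HasInvolution.finite_support hE v
  | typeC ω h1 h2 =>
    obtain ⟨v, rfl⟩ := hφ
    exact HasInvolution.finite_support hE v

theorem finiteDimensional_spanOf (E : Module.Basis ℕ ℂ V) (S : Finset ℕ) :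
    FiniteDimensional ℂ (spanOf E S) :=
  FiniteDimensional.span_of_finite ℂ (S.finite_toSet.image E)

theorem mem_glOf_of_sub_mem {E : Module.Basis ℕ ℂ V} {S : Finset ℕ} {g : V ≃ₗ[ℂ] V}
    (h : ∀ x, g x - x ∈ spanOf E S) (h' : ∀ i ∉ S, g (E i) = E i) : g ∈ glOf E S := by
  refine ⟨?_, h'⟩
  have := finiteDimensional_spanOf E S
  refine Submodule.eq_of_le_of_finrank_eq ?_ (LinearEquiv.finrank_map_eq g _)
  rintro _ ⟨x, hx, rfl⟩
  have := Submodule.add_mem _ (h x) hx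
  rwa [sub_add_cancel] at this

theorem mem_spanOf_iff {E : Module.Basis ℕ ℂ V} {S : Finset ℕ} {x : V} :
    x ∈ spanOf E S ↔ ∀ i ∉ S, E.repr x i = 0 := by
  rw [spanOf, Module.Basis.mem_span_image]
  constructor
  · intro h i hi
    by_contra hne
    exact hi (h (Finsupp.mem_support_iff.2 hne))
  · intro h i hi
    by_contra hne
    exact Finsupp.mem_support_iff.1 hi (h i hne)

theorem basis_mem_spanOf (E : Module.Basis ℕ ℂ V) {S : Finset ℕ} {i : ℕ} (hi : i ∈ S) :
    E i ∈ spanOf E S :=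
  Submodule.subset_span ⟨i, hi, rfl⟩

theorem spanOf_mono (E : Module.Basis ℕ ℂ V) {S T : Finset ℕ} (h : S ⊆ T) :
    spanOf E S ≤ spanOf E T :=
  Submodule.span_mono (Set.image_mono h)

theorem exists_le_spanOf (E : Module.Basis ℕ ℂ V) {D : Submodule ℂ V} (hD : D.FG) :
    ∃ S, D ≤ spanOf E S := by
  obtain ⟨s, rfl⟩ := hD
  refine ⟨s.biUnion fun v => (E.repr v).support, Submodule.span_le.2 fun v hv => ?_⟩
  refine mem_spanOf_iff.2 fun i hi => ?_
  by_contra hne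
  exact hi (Finset.mem_biUnion.2 ⟨v, hv, Finsupp.mem_support_iff.2 hne⟩)

theorem sub_mem_spanOf_of_mem_glOf {E : Module.Basis ℕ ℂ V} {S : Finset ℕ} {g : V ≃ₗ[ℂ] V}
    (hg : g ∈ glOf E S) (x : V) : g x - x ∈ spanOf E S := by
  have hx : x ∈ Submodule.span ℂ (Set.range E) := by rw [E.span_eq]; trivial
  induction hx using Submodule.span_induction with
  | mem x hx =>
    obtain ⟨i, rfl⟩ := hx
    by_cases hi : i ∈ S
    · refine Submodule.sub_mem _ ?_ (basis_mem_spanOf E hi)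
      rw [← hg.1]
      exact ⟨_, basis_mem_spanOf E hi, rfl⟩
    · rw [hg.2 i hi, sub_self]
      exact Submodule.zero_mem _
  | zero => simp
  | add x y _ _ hx hy =>
    rw [map_add, add_sub_add_comm]
    exact Submodule.add_mem _ hx hy
  | smul c x _ hx =>
    rw [map_smul, ← smul_sub]
    exact Submodule.smul_mem _ c hx

theorem glOf_mono (E : Module.Basis ℕ ℂ V) {S T : Finset ℕ} (h : S ⊆ T) : glOf E S ≤ glOf E T :=
  fun _ hg => mem_glOf_of_sub_mem (fun x => spanOf_mono E h (sub_mem_spanOf_of_mem_glOf hg x))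
    fun i hi => hg.2 i fun hiS => hi (h hiS)

/-- Both `g - 1` and its transpose on `V_*` have finite rank. The first image lies in the span of
finitely many basis vectors. The second is spanned by finitely many forms in `V_*`, each nonzero on
only finitely many basis vectors; on the other basis vectors every form of `V_*` kills `(g - 1) (E
i)`, which is therefore zero. -/
theorem exists_mem_glOf {t : ClassicalType V} {E : Module.Basis ℕ ℂ V} (hE : t.IsAdmissible E)
    (g : t.indGroup) : ∃ S, (g : V ≃ₗ[ℂ] V) ∈ glOf E S := by
  obtain ⟨g, ⟨hg, ⟨W, hW, hgW⟩, ⟨X, hX, hgX⟩⟩, -⟩ := g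
  change ∃ S, g ∈ glOf E S
  let d : V →ₗ[ℂ] V := (g : V →ₗ[ℂ] V) - LinearMap.id
  have hd : (LinearMap.range d).FG := by
    rw [Submodule.range_fg_iff_ker_cofg]
    refine Submodule.CoFG.of_le (fun w hw => ?_) hW
    simp [d, hgW w hw]
  obtain ⟨S, hS⟩ := exists_le_spanOf E hd
  let Φ : t.dualSpace →ₗ[ℂ] Module.Dual ℂ V := LinearMap.lcomp ℂ ℂ d ∘ₗ t.dualSpace.subtype
  have hΦ : (LinearMap.range Φ).FG := by
    rw [Submodule.range_fg_iff_ker_cofg]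
    refine Submodule.CoFG.of_le (fun φ hφ => ?_) hX
    ext v
    have := LinearMap.congr_fun (hgX φ hφ) v
    simpa [Φ, d, sub_eq_zero] using this
  obtain ⟨s, hs⟩ := hΦ
  have hsV : ∀ ψ ∈ s, {i | ψ (E i) ≠ 0}.Finite := by
    intro ψ hψ
    refine finite_support_of_mem_dualSpace hE ?_
    have h1 : ψ ∈ LinearMap.range Φ := hs ▸ Submodule.subset_span hψ
    obtain ⟨φ, rfl⟩ := h1
    have : Φ φ = (φ : Module.Dual ℂ V) ∘ₗ (g : V →ₗ[ℂ] V) - φ := by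
      ext v; simp [Φ, d]
    rw [this]
    exact Submodule.sub_mem _ ((hg _).2 φ.2) φ.2
  have hT : (⋃ ψ ∈ s, {i | ψ (E i) ≠ 0}).Finite := s.finite_toSet.biUnion hsV
  refine ⟨S ∪ hT.toFinset, mem_glOf_of_sub_mem (fun x => ?_) fun i hi => ?_⟩
  · exact spanOf_mono E Finset.subset_union_left (hS ⟨x, rfl⟩)
  · rw [← sub_eq_zero]
    refine t.eq_zero_of_forall_dualSpace fun φ hφ => ?_
    have h1 : Φ ⟨φ, hφ⟩ ∈ Submodule.span ℂ (s : Set (Module.Dual ℂ V)) := hs ▸ ⟨_, rfl⟩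
    have h2 : Submodule.span ℂ (s : Set (Module.Dual ℂ V)) ≤
        LinearMap.ker (Module.Dual.eval ℂ V (E i)) := by
      refine Submodule.span_le.2 fun ψ hψ => ?_
      change ψ (E i) = 0
      by_contra hne
      exact hi (Finset.mem_union_right _ (hT.mem_toFinset.2 (Set.mem_biUnion hψ hne)))
    exact h2 h1

theorem IsFiltration.exists_subset {t : ClassicalType V} {E : Module.Basis ℕ ℂ V}
    {En : ℕ → Finset ℕ} (h : t.IsFiltration E En) (S : Finset ℕ) :
    ∃ n, ∀ m ≥ n, S ⊆ En m := by
  choose n hn using h.2.1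
  exact ⟨S.sup n, fun m hm i hi => h.1 ((Finset.le_sup hi).trans hm) (hn i)⟩

theorem IsFiltration.exists_mem_finGroup {t : ClassicalType V} {E : Module.Basis ℕ ℂ V}
    {En : ℕ → Finset ℕ} (h : t.IsFiltration E En) (hE : t.IsAdmissible E) (g : t.indGroup) :
    ∃ n, ∀ m ≥ n, g ∈ t.finGroup E (En m) := by
  obtain ⟨S, hS⟩ := exists_mem_glOf hE g
  obtain ⟨n, hn⟩ := h.exists_subset S
  exact ⟨n, fun m hm => glOf_mono E (hn m hm) hS⟩

/-! ### Subspaces stable under the diagonal group -/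

theorem form_basis_left {ω : LinearMap.BilinForm ℂ V} {E : Module.Basis ℕ ℂ V} {σ : ℕ → ℕ}
    (hσ : ∀ i j, ω (E i) (E j) ≠ 0 ↔ j = σ i) (i : ℕ) (x : V) :
    ω (E i) x = ω (E i) (E (σ i)) * E.repr x (σ i) := by
  have : ω (E i) = ω (E i) (E (σ i)) • E.coord (σ i) := by
    refine E.ext fun j => ?_
    by_cases hj : j = σ i
    · subst hj; simp
    · have h0 : ω (E i) (E j) = 0 := by
        by_contra hne
        exact hj ((hσ i j).1 hne)
      simp [h0, hj]
  exact LinearMap.congr_fun this x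

theorem form_basis_right {ω : LinearMap.BilinForm ℂ V} {E : Module.Basis ℕ ℂ V} {σ : ℕ → ℕ}
    (hinv : Function.Involutive σ) (hσ : ∀ i j, ω (E i) (E j) ≠ 0 ↔ j = σ i) (i : ℕ) (x : V) :
    ω x (E i) = ω (E (σ i)) (E i) * E.repr x (σ i) := by
  have : ω.flip (E i) = ω (E (σ i)) (E i) • E.coord (σ i) := by
    refine E.ext fun j => ?_
    by_cases hj : j = σ i
    · subst hj; simp
    · have h0 : ω (E j) (E i) = 0 := by
        by_contra hne
        exact hj (by rw [(hσ j i).1 hne, hinv])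
      simp [h0, hj]
  exact LinearMap.congr_fun this x

theorem HasForm.coord_mem_dualSpace {t : ClassicalType V} {ω : LinearMap.BilinForm ℂ V}
    (hω : t.HasForm ω) {E : Module.Basis ℕ ℂ V} (hE : t.IsAdmissible E) (i : ℕ) :
    E.coord i ∈ t.dualSpace := by
  obtain ⟨σ, hinv, -, hσ⟩ := hω.hasInvolution E hE
  have hne : ω (E (σ i)) (E i) ≠ 0 := (hσ _ _).2 (hinv i).symm
  rw [hω.dualSpace_eq]
  refine ⟨(ω (E (σ i)) (E i))⁻¹ • E (σ i), ?_⟩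
  ext x
  have hx := form_basis_left hσ (σ i) x
  rw [hinv] at hx
  rw [map_smul, LinearMap.smul_apply, hx, smul_eq_mul, inv_mul_cancel_left₀ hne,
    Module.Basis.coord_apply]

theorem dilatransvection_mem_glOf {E : Module.Basis ℕ ℂ V} {S : Finset ℕ} {i : ℕ} (hi : i ∈ S)
    {c : ℂ} (h : IsUnit (1 + (c • E.coord i) (E i))) :
    LinearEquiv.dilatransvection h ∈ glOf E S := by
  refine mem_glOf_of_sub_mem (fun x => ?_) fun j hj => ?_
  · rw [LinearEquiv.dilatransvection.apply, add_sub_cancel_left]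
    exact Submodule.smul_mem _ _ (basis_mem_spanOf E hi)
  · have : j ≠ i := fun h => hj (h ▸ hi)
    rw [LinearEquiv.dilatransvection.apply]
    simp [this]

/-- A diagonal isometry isolates the `i`-th component: the sign change at `i` if `σ i = i`,
otherwise the element `d` scaling `E i` by 2 and `E (σ i)` by 1/2. -/
theorem HasForm.basis_mem_of_torus_stable {t : ClassicalType V} {ω : LinearMap.BilinForm ℂ V}
    (hω : t.HasForm ω) {E : Module.Basis ℕ ℂ V} (hE : t.IsAdmissible E) {S : Finset ℕ}
    (hS : t.IsStable E S) {F : Submodule ℂ V}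
    (hF : ∀ g ∈ t.cartan E, g ∈ t.finGroup E S → ∀ x ∈ F, (g : V ≃ₗ[ℂ] V) x ∈ F)
    {i : ℕ} (hi : i ∈ S) {x : V} (hx : x ∈ F) (hxi : E.repr x i ≠ 0) : E i ∈ F := by
  obtain ⟨σ, hinv, -, hσ⟩ := hω.hasInvolution E hE
  have hdil : ∀ (j : ℕ) (c : ℂ) (h : IsUnit (1 + (c • E.coord j) (E j))),
      LinearEquiv.dilatransvection h ∈ finitaryGL t.dualSpace := fun j c h =>
    dilatransvection_mem_finitaryGL h (Submodule.smul_mem _ c (hω.coord_mem_dualSpace hE j))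
  by_cases hfix : σ i = i
  · have h : IsUnit (1 + ((-2 : ℂ) • E.coord i) (E i)) := by simp; norm_num
    have happ : ∀ y, LinearEquiv.dilatransvection h y = y - (2 * E.repr y i) • E i := by
      intro y
      rw [LinearEquiv.dilatransvection.apply, sub_eq_add_neg, ← neg_smul]
      simp
    have hiso : LinearEquiv.dilatransvection h ∈ t.isometries := by
      rw [hω.mem_isometries_iff]
      intro y z
      have h1 := form_basis_left hσ i z
      have h2 := form_basis_right hinv hσ i y
      rw [hfix] at h1 h2
      simp only [happ, map_sub, map_smul, LinearMap.sub_apply, LinearMap.smul_apply, smul_eq_mul,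
        h1, h2]
      ring
    have hmem := hF ⟨LinearEquiv.dilatransvection h, hdil i _ h, hiso⟩ ?_
      (dilatransvection_mem_glOf hi h) x hx
    · change LinearEquiv.dilatransvection h x ∈ F at hmem
      rw [happ, Submodule.sub_mem_iff_right _ hx] at hmem
      exact (Submodule.smul_mem_iff _ (mul_ne_zero two_ne_zero hxi)).1 hmem
    · intro j
      change ∃ c : ℂ, LinearEquiv.dilatransvection h (E j) = c • E j
      by_cases hj : j = i
      · subst hj
        refine ⟨-1, ?_⟩
        rw [happ, Module.Basis.repr_self, Finsupp.single_eq_same]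
        module
      · exact ⟨1, by rw [happ]; simp [hj]⟩
  · have h : IsUnit (1 + ((1 : ℂ) • E.coord i) (E i)) := by simp
    have h' : IsUnit (1 + ((-(1 / 2) : ℂ) • E.coord (σ i)) (E (σ i))) := by simp; norm_num
    let d : V ≃ₗ[ℂ] V := LinearEquiv.dilatransvection h * LinearEquiv.dilatransvection h'
    have happ : ∀ y, d y = y + E.repr y i • E i - (E.repr y (σ i) / 2) • E (σ i) := by
      intro y
      change LinearEquiv.dilatransvection h (LinearEquiv.dilatransvection h' y) = _
      rw [LinearEquiv.dilatransvection.apply, LinearEquiv.dilatransvection.apply]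
      have : i ≠ σ i := fun h => hfix h.symm
      simp [this]
      module
    have hiso : d ∈ t.isometries := by
      rw [hω.mem_isometries_iff]
      intro y z
      have h1 := form_basis_left hσ i z
      have h2 := form_basis_right hinv hσ i y
      have h3 := form_basis_left hσ (σ i) z
      have h4 := form_basis_right hinv hσ (σ i) y
      have h5 := form_basis_left hσ i (E i)
      have h6 := form_basis_left hσ (σ i) (E (σ i))
      have : i ≠ σ i := fun h => hfix h.symm
      rw [hinv] at h3 h4 h6
      simp only [Module.Basis.repr_self, Finsupp.single_apply, this, hfix, if_false, mul_zero]
        at h5 h6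
      simp only [happ, map_sub, map_add, map_smul, LinearMap.sub_apply, LinearMap.add_apply,
        LinearMap.smul_apply, smul_eq_mul, h1, h2, h3, h4, h5, h6]
      ring
    have hd : d ∈ t.indGroup := ⟨mul_mem (hdil i _ h) (hdil (σ i) _ h'), hiso⟩
    have hdS : d ∈ glOf E S := mul_mem (dilatransvection_mem_glOf hi h)
      (dilatransvection_mem_glOf
        (hω.mem_of_isStable E S hS i hi (σ i) ((hσ _ _).2 rfl)) h')
    have hcart : (⟨d, hd⟩ : t.indGroup) ∈ t.cartan E := by
      intro j
      change ∃ c : ℂ, d (E j) = c • E j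
      by_cases hj : j = i
      · subst hj
        refine ⟨2, ?_⟩
        rw [happ]
        simp [hfix, two_smul]
      · by_cases hj' : j = σ i
        · subst hj'
          refine ⟨1 / 2, ?_⟩
          rw [happ]
          simp [hfix]
          module
        · exact ⟨1, by rw [happ]; simp [hj, hj']⟩
    have hd1 : ∀ y ∈ F, E.repr y i • E i - (E.repr y (σ i) / 2) • E (σ i) ∈ F := by
      intro y hy
      have := hF ⟨d, hd⟩ hcart hdS y hy
      change d y ∈ F at this
      rwa [happ, add_sub_assoc, Submodule.add_mem_iff_right _ hy] at this
    have h1 := hd1 x hx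
    have h2 := hd1 _ h1
    have h3 : E.repr x i • E i ∈ F := by
      -- `d - 1` has eigenvalues 1 and -1/2 on `E i` and `E (σ i)`; the polynomial (T + 2T²)/3 takes
      -- the values 1 and 0 there.
      have := Submodule.add_mem _ (Submodule.smul_mem F (1 / 3 : ℂ) h1)
        (Submodule.smul_mem F (2 / 3 : ℂ) h2)
      convert this using 1
      simp [hfix, Ne.symm hfix]
      module
    exact (Submodule.smul_mem_iff _ hxi).1 h3

theorem basis_mem_of_cartan_stable {t : ClassicalType V} {E : Module.Basis ℕ ℂ V}
    (hE : t.IsAdmissible E) {S : Finset ℕ} (hS : t.IsStable E S) {F : Submodule ℂ V}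
    (hF : ∀ g ∈ t.cartan E, g ∈ t.finGroup E S → ∀ x ∈ F, (g : V ≃ₗ[ℂ] V) x ∈ F)
    {i : ℕ} (hi : i ∈ S) {x : V} (hx : x ∈ F) (hxi : E.repr x i ≠ 0) : E i ∈ F := by
  cases t with
  | typeA Vs h1 h2 =>
    have h : IsUnit (1 + ((1 : ℂ) • E.coord i) (E i)) := by simp
    have hV : Submodule.span ℂ (Set.range E.coord) = Vs := hE
    have hmem := hF ⟨LinearEquiv.dilatransvection h, dilatransvection_mem_finitaryGL h
        (Submodule.smul_mem _ _ (hV ▸ Submodule.subset_span ⟨i, rfl⟩)), trivial⟩ ?_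
      (dilatransvection_mem_glOf hi h) x hx
    · change LinearEquiv.dilatransvection h x ∈ F at hmem
      rw [LinearEquiv.dilatransvection.apply, Submodule.add_mem_iff_right _ hx, one_smul,
        Module.Basis.coord_apply] at hmem
      exact (Submodule.smul_mem_iff _ hxi).1 hmem
    · intro j
      change ∃ c : ℂ, LinearEquiv.dilatransvection h (E j) = c • E j
      rw [LinearEquiv.dilatransvection.apply]
      by_cases hj : j = i
      · subst hj
        exact ⟨2, by simp [two_smul]⟩
      · exact ⟨1, by simp [hj]⟩
  | typeBD ω h1 h2 => exact (hasForm_typeBD ω h1 h2).basis_mem_of_torus_stable hE hS hF hi hx hxi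
  | typeC ω h1 h2 => exact (hasForm_typeC ω h1 h2).basis_mem_of_torus_stable hE hS hF hi hx hxi

theorem apply_eq_self_of_mem_glOf {E : Module.Basis ℕ ℂ V} {S : Finset ℕ} {g : V ≃ₗ[ℂ] V}
    (hg : g ∈ glOf E S) {x : V} (hx : ∀ i ∈ S, E.repr x i = 0) : g x = x := by
  conv_lhs => rw [← E.linearCombination_repr x]
  conv_rhs => rw [← E.linearCombination_repr x]
  rw [Finsupp.linearCombination_apply, Finsupp.sum, map_sum]
  refine Finset.sum_congr rfl fun i hi => ?_
  rw [map_smul, hg.2 i fun hiS => Finsupp.mem_support_iff.1 hi (hx i hiS)]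

/-- If `F` contains no `E j` with `j ∈ S`, its vectors have no coordinates in `S` and `g` fixes
them. If it contains all of them, it contains the image of `g - 1`. Either way `g` would preserve
`F`. -/
theorem exists_basis_mem_and_notMem {t : ClassicalType V} {E : Module.Basis ℕ ℂ V}
    (hE : t.IsAdmissible E) {S T : Finset ℕ} (hST : S ⊆ T) (hT : t.IsStable E T)
    {F : Submodule ℂ V}
    (hF : ∀ g ∈ t.cartan E, g ∈ t.finGroup E T → ∀ x ∈ F, (g : V ≃ₗ[ℂ] V) x ∈ F)
    {g : V ≃ₗ[ℂ] V} (hg : g ∈ glOf E S) (hgF : F.map (g : V →ₗ[ℂ] V) ≠ F) :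
    (∃ j ∈ S, E j ∈ F) ∧ ∃ i ∈ S, E i ∉ F := by
  constructor
  · by_contra! hcon
    have hfix : ∀ x ∈ F, g x = x := fun x hx => apply_eq_self_of_mem_glOf hg fun j hj => by
      by_contra hne
      exact hcon j hj (basis_mem_of_cartan_stable hE hT hF (hST hj) hx hne)
    apply hgF
    ext x
    constructor
    · rintro ⟨y, hy, rfl⟩
      rwa [LinearEquiv.coe_coe, hfix y hy]
    · exact fun hx => ⟨x, hx, hfix x hx⟩
  · by_contra! hcon
    have hle : spanOf E S ≤ F := Submodule.span_le.2 (by rintro _ ⟨i, hi, rfl⟩; exact hcon i hi)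
    have hstab : ∀ h ∈ glOf E S, ∀ x ∈ F, h x ∈ F := fun h hh x hx => by
      have := Submodule.add_mem _ (hle (sub_mem_spanOf_of_mem_glOf hh x)) hx
      rwa [sub_add_cancel] at this
    apply hgF
    ext x
    constructor
    · rintro ⟨y, hy, rfl⟩
      exact hstab g hg y hy
    · exact fun hx => ⟨g.symm x, hstab _ ((glOf E S).inv_mem hg) x hx, g.apply_symm_apply x⟩

/-! ### Stable subspaces of proper splitting parabolic subgroups -/

theorem exists_frequently_of_forall_exists {ι : Type*} (S : Finset ι) {p : ℕ → ι → Prop} {n : ℕ}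
    (h : ∀ m ≥ n, ∃ j ∈ S, p m j) : ∃ j ∈ S, ∃ᶠ m in Filter.atTop, p m j := by
  by_contra! hcon
  obtain ⟨m, hm, hm'⟩ := (((Filter.eventually_all_finset S).2 hcon).and
    (Filter.eventually_ge_atTop n)).exists
  obtain ⟨j, hj, hpj⟩ := h m hm'
  exact hm j hj hpj

/-- The smallest `P`-stable subspace that contains `v`. -/
def orbitSpan {t : ClassicalType V} (P : Subgroup t.indGroup) (v : V) : Submodule ℂ V :=
  Submodule.span ℂ (Set.range fun p : P => ((p : t.indGroup) : V ≃ₗ[ℂ] V) v)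

theorem self_mem_orbitSpan {t : ClassicalType V} (P : Subgroup t.indGroup) (v : V) :
    v ∈ orbitSpan P v :=
  Submodule.subset_span ⟨1, rfl⟩

theorem apply_mem_orbitSpan {t : ClassicalType V} {P : Subgroup t.indGroup} (v : V)
    {p : t.indGroup} (hp : p ∈ P) {x : V} (hx : x ∈ orbitSpan P v) :
    (p : V ≃ₗ[ℂ] V) x ∈ orbitSpan P v := by
  have : orbitSpan P v ≤ (orbitSpan P v).comap ((p : V ≃ₗ[ℂ] V) : V →ₗ[ℂ] V) := by
    refine Submodule.span_le.2 ?_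
    rintro _ ⟨q, rfl⟩
    exact Submodule.subset_span ⟨⟨p, hp⟩ * q, rfl⟩
  exact this hx

/-- If `P` is proper, then for all large `n` some member of the flag of `P ∩ G(E_n)` separates two
vectors of a fixed finite part of the basis. -/
theorem exists_separating_flag_members {t : ClassicalType V} {P : Subgroup t.indGroup}
    (hP : P ≠ ⊤) {E : Module.Basis ℕ ℂ V} {En : ℕ → Finset ℕ} (hE : t.IsAdmissible E)
    (hEn : t.IsFiltration E En) (hH : t.cartan E ≤ P)
    (hpar : ∀ n, t.IsParabolicIn E (En n) (P ⊓ t.finGroup E (En n))) :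
    ∃ n, ∀ m ≥ n, ∃ 𝓕 F, t.IsFlagIn (spanOf E (En m)) 𝓕 ∧ F ∈ 𝓕 ∧
      (∀ F' ∈ 𝓕, ∀ g ∈ P, g ∈ t.finGroup E (En m) → ∀ x ∈ F', (g : V ≃ₗ[ℂ] V) x ∈ F') ∧
      (∃ j ∈ En n, E j ∈ F) ∧ ∃ i ∈ En n, E i ∉ F := by
  obtain ⟨g, hg⟩ : ∃ g, g ∉ P := by
    by_contra! h
    exact hP ((Subgroup.eq_top_iff' P).2 h)
  obtain ⟨n, hn⟩ := hEn.exists_mem_finGroup hE g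
  refine ⟨n, fun m hm => ?_⟩
  obtain ⟨𝓕, h𝓕, hstab⟩ := hpar m
  have hst : ∀ F' ∈ 𝓕, ∀ g ∈ P, g ∈ t.finGroup E (En m) → ∀ x ∈ F', (g : V ≃ₗ[ℂ] V) x ∈ F' := by
    intro F' hF' p hp hp' x hx
    rw [← ((hstab p).1 ⟨hp, hp'⟩).2 F' hF']
    exact ⟨x, hx, rfl⟩
  obtain ⟨F, hF, hgF⟩ : ∃ F ∈ 𝓕, F.map ((g : V ≃ₗ[ℂ] V) : V →ₗ[ℂ] V) ≠ F := by
    by_contra! h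
    exact hg ((hstab g).2 ⟨hn m hm, h⟩).1
  exact ⟨𝓕, F, h𝓕, hF, hst, exists_basis_mem_and_notMem hE (hEn.1 hm) (hEn.2.2 m)
    (fun p hp => hst F hF p (hH hp)) (hn n le_rfl) hgF⟩

/-- The flags at different levels are not assumed compatible, so their members cannot be glued.
Instead, one pair `(i, j)` is separated at infinitely many levels, and the span of the `P`-orbit of
`E j` is used. Each `p ∈ P` lives at such a level, where the flag member contains `p (E j)` but not
`E i`, so the `i`-th coordinate of `p (E j)` vanishes. -/
theorem IsSplittingParabolic.exists_stable_subspace {t : ClassicalType V}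
    {P : Subgroup t.indGroup} (h : t.IsSplittingParabolic P) (hP : P ≠ ⊤) :
    ∃ E : Module.Basis ℕ ℂ V, t.IsAdmissible E ∧ ∃ F : Submodule ℂ V,
      (∀ p ∈ P, ∀ x ∈ F, (p : V ≃ₗ[ℂ] V) x ∈ F) ∧ ∃ i j, E j ∈ F ∧ ∀ x ∈ F, E.coord i x = 0 := by
  obtain ⟨E, En, hE, hEn, hH, hpar⟩ := h
  obtain ⟨n, hn⟩ := exists_separating_flag_members hP hE hEn hH hpar
  obtain ⟨⟨i, j⟩, hij, hfr⟩ := exists_frequently_of_forall_exists (En n ×ˢ En n)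
    (p := fun m ij => n ≤ m ∧ ∃ F : Submodule ℂ V,
      (∀ g ∈ P, g ∈ t.finGroup E (En m) → ∀ x ∈ F, (g : V ≃ₗ[ℂ] V) x ∈ F) ∧
      E ij.2 ∈ F ∧ E ij.1 ∉ F) (n := n) (by
      intro m hm
      obtain ⟨𝓕, F, -, hF, hst, ⟨j, hj, hjF⟩, i, hi, hiF⟩ := hn m hm
      exact ⟨(i, j), Finset.mk_mem_product hi hj, hm, F, hst F hF, hjF, hiF⟩)
  refine ⟨E, hE, orbitSpan P (E j), fun p hp x hx => apply_mem_orbitSpan _ hp hx, i, j,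
    self_mem_orbitSpan P _, ?_⟩
  have hle : orbitSpan P (E j) ≤ LinearMap.ker (E.coord i) := by
    refine Submodule.span_le.2 ?_
    rintro _ ⟨⟨p, hp⟩, rfl⟩
    obtain ⟨k, hk⟩ := hEn.exists_mem_finGroup hE p
    obtain ⟨m, ⟨hnm, F, hst, hjF, hiF⟩, hkm⟩ :=
      (hfr.and_eventually (Filter.eventually_ge_atTop k)).exists
    change E.repr ((p : V ≃ₗ[ℂ] V) (E j)) i = 0
    by_contra hne
    exact hiF (basis_mem_of_cartan_stable hE (hEn.2.2 m) (fun q hq => hst q (hH hq))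
      (hEn.1 hnm (Finset.mem_product.1 hij).1) (hst p hp (hk m hkm) _ hjF) hne)
  exact fun x hx => hle hx

/-- `F` and its orthogonal are comparable, so the smaller one is isotropic. If that is the
orthogonal, `E i ∉ F` forces the `i`-th coordinate to vanish on `F`, which puts `E (σ i)` in the
orthogonal. -/
theorem HasForm.exists_isotropic_flag_member {t : ClassicalType V} {ω : LinearMap.BilinForm ℂ V}
    (hω : t.HasForm ω) {E : Module.Basis ℕ ℂ V} (hE : t.IsAdmissible E) {S T : Finset ℕ}
    (hST : S ⊆ T) (hS : t.IsStable E S) (hT : t.IsStable E T) {𝓕 : Set (Submodule ℂ V)}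
    (h𝓕 : t.IsFlagIn (spanOf E T) 𝓕) {F : Submodule ℂ V} (hF : F ∈ 𝓕)
    (hst : ∀ g ∈ t.cartan E, g ∈ t.finGroup E T → ∀ x ∈ F, (g : V ≃ₗ[ℂ] V) x ∈ F)
    (hj : ∃ j ∈ S, E j ∈ F) (hi : ∃ i ∈ S, E i ∉ F) :
    ∃ F' ∈ 𝓕, (∃ j ∈ S, E j ∈ F') ∧ ∀ x ∈ F', ∀ y ∈ F', ω x y = 0 := by
  obtain ⟨σ, hinv, -, hσ⟩ := hω.hasInvolution E hE
  have hF' := hω.orthogonal_mem _ _ h𝓕 F hF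
  rcases h𝓕.2.2.2.1.total hF hF' with hle | hle
  · refine ⟨F, hF, hj, fun x hx y hy => ?_⟩
    exact (hle hy).2 x hx
  · obtain ⟨i, hiS, hiF⟩ := hi
    have hσi : σ i ∈ S := hω.mem_of_isStable E S hS i hiS (σ i) ((hσ _ _).2 rfl)
    refine ⟨_, hF', ⟨σ i, hσi, basis_mem_spanOf E (hST hσi), fun x hx => ?_⟩, fun x hx y hy => ?_⟩
    · change ω x (E (σ i)) = 0
      rw [form_basis_right hinv hσ, hinv]
      by_contra hne
      exact hiF (basis_mem_of_cartan_stable hE hT hst (hST hiS) hx (right_ne_zero_of_mul hne))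
    · exact hy.2 x (hle hx)

theorem IsSplittingParabolic.exists_isotropic_stable_subspace {t : ClassicalType V}
    {ω : LinearMap.BilinForm ℂ V} (hω : t.HasForm ω) {P : Subgroup t.indGroup}
    (h : t.IsSplittingParabolic P) (hP : P ≠ ⊤) :
    ∃ E : Module.Basis ℕ ℂ V, t.IsAdmissible E ∧ ∃ F : Submodule ℂ V,
      (∀ p ∈ P, ∀ x ∈ F, (p : V ≃ₗ[ℂ] V) x ∈ F) ∧ (∃ j, E j ∈ F) ∧
      (∀ x ∈ F, ∀ y ∈ F, ω x y = 0) ∧ ∀ i, ∀ x ∈ F, E.repr x i ≠ 0 → E i ∈ F := by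
  obtain ⟨E, En, hE, hEn, hH, hpar⟩ := h
  obtain ⟨n, hn⟩ := exists_separating_flag_members hP hE hEn hH hpar
  obtain ⟨j, hj, hfr⟩ := exists_frequently_of_forall_exists (En n)
    (p := fun m j => ∃ F : Submodule ℂ V,
      (∀ g ∈ P, g ∈ t.finGroup E (En m) → ∀ x ∈ F, (g : V ≃ₗ[ℂ] V) x ∈ F) ∧
      E j ∈ F ∧ ∀ x ∈ F, ∀ y ∈ F, ω x y = 0) (n := n) (by
      intro m hm
      obtain ⟨𝓕, F, h𝓕, hF, hst, hj, hi⟩ := hn m hm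
      obtain ⟨F', hF', ⟨j, hj, hjF⟩, hiso⟩ := hω.exists_isotropic_flag_member hE (hEn.1 hm)
        (hEn.2.2 n) (hEn.2.2 m) h𝓕 hF (fun p hp => hst F hF p (hH hp)) hj hi
      exact ⟨j, hj, F', hst F' hF', hjF, hiso⟩)
  refine ⟨E, hE, orbitSpan P (E j), fun p hp x hx => apply_mem_orbitSpan _ hp hx,
    ⟨j, self_mem_orbitSpan P _⟩, ?_, ?_⟩
  · intro x hx y hy
    have hgen : ∀ p q : P, ω ((p : t.indGroup).1 (E j)) ((q : t.indGroup).1 (E j)) = 0 := by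
      rintro ⟨p, hp⟩ ⟨q, hq⟩
      obtain ⟨k, hk⟩ := hEn.exists_mem_finGroup hE p
      obtain ⟨k', hk'⟩ := hEn.exists_mem_finGroup hE q
      obtain ⟨m, ⟨F, hst, hjF, hiso⟩, hkm, hkm'⟩ := (hfr.and_eventually
        ((Filter.eventually_ge_atTop k).and (Filter.eventually_ge_atTop k'))).exists
      exact hiso _ (hst p hp (hk m hkm) _ hjF) _ (hst q hq (hk' m hkm') _ hjF)
    have h1 : ∀ p : P, orbitSpan P (E j) ≤ LinearMap.ker (ω ((p : t.indGroup).1 (E j))) := by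
      intro p
      refine Submodule.span_le.2 ?_
      rintro _ ⟨q, rfl⟩
      exact hgen p q
    have h2 : orbitSpan P (E j) ≤ LinearMap.ker (ω.flip y) := by
      refine Submodule.span_le.2 ?_
      rintro _ ⟨p, rfl⟩
      exact h1 p hy
    exact h2 hx
  · intro i x hx hne
    obtain ⟨m, hm⟩ := hEn.2.1 i
    exact basis_mem_of_cartan_stable hE (hEn.2.2 m)
      (fun p hp _ y hy => apply_mem_orbitSpan _ (hH hp) hy) hm hx hne

/-! ### Transitivity of the general linear group -/

/-- A vector space is not the union of two proper subspaces. -/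
theorem exists_apply_ne_zero_and_ne_zero {M : Type*} [AddCommGroup M] [Module ℂ M]
    {φ ψ : Module.Dual ℂ M} (hφ : φ ≠ 0) (hψ : ψ ≠ 0) : ∃ x, φ x ≠ 0 ∧ ψ x ≠ 0 := by
  obtain ⟨x, hx⟩ := DFunLike.ne_iff.1 hφ
  obtain ⟨y, hy⟩ := DFunLike.ne_iff.1 hψ
  rw [LinearMap.zero_apply] at hx hy
  by_cases h1 : ψ x = 0
  · by_cases h2 : φ y = 0
    · exact ⟨x + y, by rwa [map_add, h2, add_zero], by rwa [map_add, h1, zero_add]⟩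
    · exact ⟨y, h2, hy⟩
  · exact ⟨x, hx, h1⟩

theorem exists_mem_apply_ne_zero_and_ne_zero (t : ClassicalType V) {u v : V} (hu : u ≠ 0)
    (hv : v ≠ 0) : ∃ ξ ∈ t.dualSpace, ξ u ≠ 0 ∧ ξ v ≠ 0 := by
  have h : ∀ w : V, w ≠ 0 → Module.Dual.eval ℂ V w ∘ₗ t.dualSpace.subtype ≠ 0 := by
    intro w hw h
    exact hw (t.eq_zero_of_forall_dualSpace fun φ hφ => LinearMap.congr_fun h ⟨φ, hφ⟩)
  obtain ⟨ξ, h1, h2⟩ := exists_apply_ne_zero_and_ne_zero (h u hu) (h v hv)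
  exact ⟨ξ, ξ.2, h1, h2⟩

theorem exists_mem_finitaryGL_map_eq (t : ClassicalType V) {u v : V} (hu : u ≠ 0) (hv : v ≠ 0) :
    ∃ g ∈ finitaryGL t.dualSpace, g u = v := by
  obtain ⟨ξ, hξ, h1, h2⟩ := t.exists_mem_apply_ne_zero_and_ne_zero hu hv
  -- The determinant of this rank-one perturbation of the identity is `ξ v / ξ u`.
  have h : IsUnit (1 + ((ξ u)⁻¹ • ξ) (v - u)) := by
    rw [isUnit_iff_ne_zero, LinearMap.smul_apply, map_sub, smul_eq_mul, mul_sub,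
      inv_mul_cancel₀ h1, add_sub_cancel]
    exact mul_ne_zero (inv_ne_zero h1) h2
  refine ⟨_, dilatransvection_mem_finitaryGL h (Submodule.smul_mem _ _ hξ), ?_⟩
  rw [LinearEquiv.dilatransvection.apply, LinearMap.smul_apply, smul_eq_mul, inv_mul_cancel₀ h1,
    one_smul, add_sub_cancel]

theorem exists_mem_finitaryGL_comp_eq {Vs : Submodule ℂ (Module.Dual ℂ V)}
    {φ ψ : Module.Dual ℂ V} (hφ : φ ∈ Vs) (hψ : ψ ∈ Vs) (hφ0 : φ ≠ 0) (hψ0 : ψ ≠ 0) :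
    ∃ g ∈ finitaryGL Vs, (∀ x, φ (g x) = ψ x) ∧ ∀ a, φ a = 0 → ψ a = 0 → g a = a := by
  obtain ⟨u, h1, h2⟩ := exists_apply_ne_zero_and_ne_zero hφ0 hψ0
  have h : IsUnit (1 + (ψ - φ) ((φ u)⁻¹ • u)) := by
    rw [isUnit_iff_ne_zero, map_smul, LinearMap.sub_apply, smul_eq_mul, mul_sub,
      inv_mul_cancel₀ h1, add_sub_cancel]
    exact mul_ne_zero (inv_ne_zero h1) h2
  refine ⟨_, dilatransvection_mem_finitaryGL h (Submodule.sub_mem _ hψ hφ), fun x => ?_,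
    fun a ha ha' => ?_⟩
  · rw [LinearEquiv.dilatransvection.apply, map_add, map_smul, map_smul, smul_eq_mul, smul_eq_mul,
      inv_mul_cancel₀ h1, LinearMap.sub_apply]
    ring
  · rw [LinearEquiv.dilatransvection.apply, LinearMap.sub_apply, ha, ha', sub_zero, zero_smul,
      add_zero]

/-- After moving `u` to `v`, the transported form and `ψ` both vanish at `v`, so the element
matching the two forms can be chosen to fix `v`. -/
theorem exists_mem_finitaryGL_transport (t : ClassicalType V) {u v : V} {φ ψ : Module.Dual ℂ V}
    (hu : u ≠ 0) (hv : v ≠ 0) (hφ : φ ∈ t.dualSpace) (hψ : ψ ∈ t.dualSpace) (hφ0 : φ ≠ 0)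
    (hψ0 : ψ ≠ 0) (hφu : φ u = 0) (hψv : ψ v = 0) :
    ∃ g ∈ finitaryGL t.dualSpace, g u = v ∧ ∀ x, ψ (g x) = φ x := by
  obtain ⟨g, hg, hgu⟩ := t.exists_mem_finitaryGL_map_eq hu hv
  let χ : Module.Dual ℂ V := φ ∘ₗ (g.symm : V →ₗ[ℂ] V)
  have hχ : χ ∘ₗ (g : V →ₗ[ℂ] V) = φ := by
    ext x
    exact congrArg φ (g.symm_apply_apply x)
  have hχ' : χ ∈ t.dualSpace := by
    rw [← hg.1, hχ]
    exact hφ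
  have hχ0 : χ ≠ 0 := by
    intro h
    rw [h, LinearMap.zero_comp] at hχ
    exact hφ0 hχ.symm
  have hχv : χ v = 0 := by
    rw [← hgu, ← hφu, ← hχ]
    rfl
  obtain ⟨k, hk, hk1, hk2⟩ := exists_mem_finitaryGL_comp_eq hψ hχ' hψ0 hχ0
  refine ⟨k * g, mul_mem hk hg, ?_, fun x => ?_⟩
  · rw [LinearEquiv.mul_apply, hgu, hk2 v hψv hχv]
  · rw [LinearEquiv.mul_apply, hk1, ← hχ]
    rfl

/-! ### Transitivity of the symplectic and orthogonal groups -/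

theorem HasForm.dilatransvection_mem_indGroup {t : ClassicalType V}
    {ω : LinearMap.BilinForm ℂ V} (hω : t.HasForm ω) {c : ℂ} {u : V}
    (h : IsUnit (1 + (c • ω u) u)) (hiso : ∀ x y, ω (x + (c * ω u x) • u) (y + (c * ω u y) • u) =
      ω x y) : LinearEquiv.dilatransvection h ∈ t.indGroup := by
  refine ⟨dilatransvection_mem_finitaryGL h ?_, (hω.mem_isometries_iff _).2 fun x y => ?_⟩
  · rw [hω.dualSpace_eq]
    exact Submodule.smul_mem _ _ ⟨u, rfl⟩
  · rw [LinearEquiv.dilatransvection.apply, LinearEquiv.dilatransvection.apply]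
    exact hiso x y

theorem HasForm.form_ne_zero {t : ClassicalType V} {ω : LinearMap.BilinForm ℂ V}
    (hω : t.HasForm ω) {v : V} (hv : v ≠ 0) : ω v ≠ 0 := fun h =>
  hv (hω.nondegenerate.1 v fun x => LinearMap.congr_fun h x)

/-- The symplectic group is transitive on nonzero vectors. -/
theorem HasForm.exists_map_eq_of_isAlt {t : ClassicalType V} {ω : LinearMap.BilinForm ℂ V}
    (hω : t.HasForm ω) (alt : ω.IsAlt) {u v : V} (hu : u ≠ 0) (hv : v ≠ 0) :
    ∃ g ∈ t.indGroup, g u = v := by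
  have step : ∀ u v, ω u v ≠ 0 → ∃ g ∈ t.indGroup, g u = v := by
    intro u v huv
    have hneg : ω v u ≠ 0 := by
      rw [← alt.neg_eq]
      exact neg_ne_zero.2 huv
    -- A symplectic transvection along `v - u`, scaled to send `u` to `v`.
    have h : IsUnit (1 + ((ω v u)⁻¹ • ω (v - u)) (v - u)) := by
      rw [LinearMap.smul_apply, alt.self_eq_zero, smul_zero, add_zero]
      exact isUnit_one
    refine ⟨_, hω.dilatransvection_mem_indGroup h fun x y => ?_, ?_⟩
    · have h1 := alt.neg_eq x (v - u)
      have h2 := alt.self_eq_zero (v - u)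
      generalize v - u = w at *
      simp only [map_add, map_smul, LinearMap.add_apply, LinearMap.smul_apply, smul_eq_mul, ← h1,
        h2]
      ring
    · have : ω (v - u) u = ω v u := by
        rw [map_sub, LinearMap.sub_apply, alt.self_eq_zero, sub_zero]
      rw [LinearEquiv.dilatransvection.apply, LinearMap.smul_apply, this, smul_eq_mul,
        inv_mul_cancel₀ hneg, one_smul, add_sub_cancel]
  obtain ⟨w, h1, h2⟩ := exists_apply_ne_zero_and_ne_zero (hω.form_ne_zero hu) (hω.form_ne_zero hv)
  obtain ⟨g, hg, hgu⟩ := step u w h1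
  obtain ⟨k, hk, hkw⟩ := step w v (by rw [← alt.neg_eq]; exact neg_ne_zero.2 h2)
  exact ⟨k * g, mul_mem hk hg, by rw [LinearEquiv.mul_apply, hgu, hkw]⟩

/-- A form `ω w` that vanishes on the kernel of `ω a` is a multiple of `ω a`; by nondegeneracy `w`
is then a multiple of `a`. -/
theorem HasForm.exists_mem_orthogonal_ne_zero {t : ClassicalType V}
    {ω : LinearMap.BilinForm ℂ V} (hω : t.HasForm ω) {a u v : V}
    (hu : u ∉ Submodule.span ℂ {a}) (hv : v ∉ Submodule.span ℂ {a}) :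
    ∃ y, ω a y = 0 ∧ ω u y ≠ 0 ∧ ω v y ≠ 0 := by
  have h : ∀ w, w ∉ Submodule.span ℂ {a} → (ω w).domRestrict (LinearMap.ker (ω a)) ≠ 0 := by
    intro w hw h0
    have h1 : ω w ∈ Submodule.span ℂ (Set.range fun _ : Unit => ω a) := by
      refine mem_span_of_iInf_ker_le_ker fun x hx => ?_
      rw [iInf_const] at hx
      exact LinearMap.congr_fun h0 ⟨x, hx⟩
    rw [Set.range_const, Submodule.mem_span_singleton] at h1
    obtain ⟨c, hc⟩ := h1
    apply hw
    rw [Submodule.mem_span_singleton]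
    refine ⟨c, ?_⟩
    rw [← sub_eq_zero]
    by_contra hne
    refine hω.form_ne_zero hne ?_
    rw [map_sub, map_smul, hc, sub_self]
  obtain ⟨y, h1, h2⟩ := exists_apply_ne_zero_and_ne_zero (h u hu) (h v hv)
  exact ⟨y, y.2, h1, h2⟩

/-- The stabilizer of `a` in the orthogonal group is transitive on isotropic vectors that are
orthogonal to `a` but not multiples of `a`. -/
theorem HasForm.exists_map_eq_of_isSymm {t : ClassicalType V} {ω : LinearMap.BilinForm ℂ V}
    (hω : t.HasForm ω) (symm : ω.IsSymm) {a u v : V}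
    (hu : u ∉ Submodule.span ℂ {a}) (hv : v ∉ Submodule.span ℂ {a})
    (huu : ω u u = 0) (hvv : ω v v = 0) (hau : ω a u = 0) (hav : ω a v = 0) :
    ∃ g ∈ t.indGroup, g u = v ∧ g a = a := by
  have step : ∀ u v, ω u u = 0 → ω v v = 0 → ω a u = 0 → ω a v = 0 → ω u v ≠ 0 →
      ∃ g ∈ t.indGroup, g u = v ∧ g a = a := by
    intro u v huu hvv hau hav huv
    have hww : ω (u - v) (u - v) = -2 * ω u v := by
      simp only [map_sub, LinearMap.sub_apply, huu, hvv, symm.eq v u]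
      ring
    -- The reflection in `u - v`, a vector of square `-2 * ω u v`: it sends `u` to `v` and fixes
    -- `a`, which is orthogonal to `u - v`.
    have h : IsUnit (1 + ((ω u v)⁻¹ • ω (u - v)) (u - v)) := by
      rw [LinearMap.smul_apply, hww, smul_eq_mul, mul_left_comm, inv_mul_cancel₀ huv]
      norm_num
    refine ⟨_, hω.dilatransvection_mem_indGroup h fun x y => ?_, ?_, ?_⟩
    · have h1 := symm.eq x (u - v)
      generalize u - v = w at *
      simp only [map_add, map_smul, LinearMap.add_apply, LinearMap.smul_apply, smul_eq_mul, h1,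
        hww]
      field_simp
      ring
    · have : ω (u - v) u = -ω u v := by
        rw [map_sub, LinearMap.sub_apply, huu, zero_sub, symm.eq]
      rw [LinearEquiv.dilatransvection.apply, LinearMap.smul_apply, this, smul_eq_mul, mul_neg,
        inv_mul_cancel₀ huv, neg_one_smul, neg_sub, add_sub_cancel]
    · have : ω (u - v) a = 0 := by
        rw [symm.eq, map_sub, hau, hav, sub_zero]
      rw [LinearEquiv.dilatransvection.apply, LinearMap.smul_apply, this, smul_zero, zero_smul,
        add_zero]
  by_cases huv : ω u v = 0
  · obtain ⟨y, h0, h1, h2⟩ := hω.exists_mem_orthogonal_ne_zero hu hv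
    -- The multiple of `u` makes `w` isotropic without changing its pairings with `a`, `u` and `v`,
    -- so that two reflections lead from `u` to `v` through `w`.
    let w := y - (ω y y / (2 * ω u y)) • u
    have hww : ω w w = 0 := by
      simp only [w, map_sub, map_smul, LinearMap.sub_apply, LinearMap.smul_apply, smul_eq_mul,
        symm.eq y u, huu]
      field_simp
      ring
    have haw : ω a w = 0 := by simp [w, h0, hau]
    have huw : ω u w ≠ 0 := by simpa [w, huu] using h1
    have hwv : ω w v ≠ 0 := by
      rw [symm.eq]
      simpa [w, symm.eq v u, huv] using h2
    obtain ⟨g, hg, hgu, hga⟩ := step u w huu hww hau haw huw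
    obtain ⟨k, hk, hkw, hka⟩ := step w v hww hvv haw hav hwv
    exact ⟨k * g, mul_mem hk hg, by rw [LinearEquiv.mul_apply, hgu, hkw],
      by rw [LinearEquiv.mul_apply, hga, hka]⟩
  · exact step u v huu hvv hau hav huv

/-- The orthogonal group is transitive on bases of isotropic planes. -/
theorem HasForm.exists_map_pair_eq {t : ClassicalType V} {ω : LinearMap.BilinForm ℂ V}
    (hω : t.HasForm ω) (symm : ω.IsSymm) {u f v h : V} (hu : u ≠ 0) (hv : v ≠ 0)
    (hf : f ∉ Submodule.span ℂ {u}) (hh : h ∉ Submodule.span ℂ {v})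
    (huu : ω u u = 0) (huf : ω u f = 0) (hff : ω f f = 0)
    (hvv : ω v v = 0) (hvh : ω v h = 0) (hhh : ω h h = 0) :
    ∃ g ∈ t.indGroup, g u = v ∧ g f = h := by
  -- For `a = 0`, not being a multiple of `a` just means being nonzero.
  obtain ⟨g, hg, hgu, -⟩ := hω.exists_map_eq_of_isSymm symm (a := 0) (u := u) (v := v)
    (by simpa using hu) (by simpa using hv) huu hvv (by simp) (by simp)
  have hgω := (hω.mem_isometries_iff g).1 hg.2
  obtain ⟨k, hk, hkf, hkv⟩ := hω.exists_map_eq_of_isSymm symm (a := v) (u := g f) (v := h)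
    (fun hmem => by
      rw [Submodule.mem_span_singleton] at hmem
      obtain ⟨c, hc⟩ := hmem
      rw [← hgu, ← map_smul] at hc
      exact hf (Submodule.mem_span_singleton.2 ⟨c, g.injective hc⟩))
    hh (by rw [hgω, hff]) hhh (by rw [← hgu, hgω, huf]) hvh
  exact ⟨k * g, mul_mem hk hg, by rw [LinearEquiv.mul_apply, hgu, hkv],
    by rw [LinearEquiv.mul_apply, hkf]⟩

/-! ### The transporters in the three types -/

theorem exists_notMem_apply_ne {σ : ℕ → ℕ} (hσ : ∀ i j, σ i = i → σ j = j → i = j)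
    (T : Finset ℕ) : ∃ k ∉ T, σ k ≠ k := by
  obtain ⟨k, hk⟩ := Infinite.exists_notMem_finset T
  by_cases h : σ k = k
  · obtain ⟨m, hm⟩ := Infinite.exists_notMem_finset (insert k T)
    rw [Finset.mem_insert, not_or] at hm
    exact ⟨m, hm.2, fun hmm => hm.1 (hσ m k hmm h)⟩
  · exact ⟨k, hk, h⟩

theorem basis_notMem_span_singleton (E : Module.Basis ℕ ℂ V) {i j : ℕ} (hij : i ≠ j) :
    E i ∉ Submodule.span ℂ {E j} := by
  rw [Submodule.mem_span_singleton]
  rintro ⟨c, hc⟩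
  have := congrArg (fun x => E.repr x i) hc
  simp [hij] at this

theorem infinite_orbits_typeA (hV : Module.rank ℂ V = Cardinal.aleph0)
    (Vs : Submodule ℂ (Module.Dual ℂ V)) (h1 : Module.rank ℂ Vs = Cardinal.aleph0)
    (h2 : ∀ v : V, (∀ φ ∈ Vs, φ v = 0) → v = 0) {l : ℕ} (hl : 4 ≤ l)
    (P : Fin l → Subgroup (typeA Vs h1 h2).indGroup)
    (hP : ∀ i, (typeA Vs h1 h2).IsSplittingParabolic (P i)) (hproper : ∀ i, P i ≠ ⊤) :
    Infinite (MulAction.orbitRel.Quotient (typeA Vs h1 h2).indGroup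
      (∀ i, (typeA Vs h1 h2).indGroup ⧸ P i)) := by
  choose E hE F hF p q hq hp using fun i => (hP i).exists_stable_subspace (hproper i)
  have hcoord : ∀ i j, (E i).coord j ∈ (typeA Vs h1 h2).dualSpace := fun i j => by
    have h : Submodule.span ℂ (Set.range (E i).coord) = Vs := hE i
    change _ ∈ Vs
    rw [← h]
    exact Submodule.subset_span ⟨j, rfl⟩
  let B := E ⟨0, by omega⟩
  refine infinite_orbits_of_transporters hV _ hl P F hF (B 0) (B 1) (B.coord 0) (B.coord 1)
    (by simp) fun i s => ?_
  have hψ0 : B.coord 1 - s • B.coord 0 ≠ 0 := fun h => by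
    have := LinearMap.congr_fun h (B 1)
    simp at this
  have hv0 : B 0 + s • B 1 ≠ 0 := fun h => by
    have := congrArg (B.coord 0) h
    simp at this
  have hφ0 : (E i).coord (p i) ≠ 0 := fun h => by
    have := LinearMap.congr_fun h (E i (p i))
    simp at this
  obtain ⟨g, hg, hgu, hgφ⟩ := (typeA Vs h1 h2).exists_mem_finitaryGL_transport
    ((E i).ne_zero (q i)) hv0 (hcoord i (p i))
    (Submodule.sub_mem _ (hcoord _ 1) (Submodule.smul_mem _ s (hcoord _ 0))) hφ0 hψ0
    (hp i _ (hq i)) (by simp [B])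
  refine ⟨⟨g, hg, trivial⟩, ⟨_, hq i, hgu⟩, fun x hx => ?_⟩
  have := hgφ x
  rw [hp i x hx, LinearMap.sub_apply, LinearMap.smul_apply, smul_eq_mul, sub_eq_zero] at this
  exact this

/-- Here `a`, `b` is a hyperbolic pair. Since `F i` is isotropic, moving one of its vectors to `a +
s • b` already puts the translate in the orthogonal of `a + s • b`, which is the kernel of `β - s •
α`. -/
theorem infinite_orbits_of_isAlt (hV : Module.rank ℂ V = Cardinal.aleph0) {t : ClassicalType V}
    {ω : LinearMap.BilinForm ℂ V} (hω : t.HasForm ω) (alt : ω.IsAlt) {l : ℕ} (hl : 4 ≤ l)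
    (P : Fin l → Subgroup t.indGroup) (hP : ∀ i, t.IsSplittingParabolic (P i))
    (hproper : ∀ i, P i ≠ ⊤) :
    Infinite (MulAction.orbitRel.Quotient t.indGroup (∀ i, t.indGroup ⧸ P i)) := by
  choose E hE F hF hj hiso _ using fun i =>
    (hP i).exists_isotropic_stable_subspace hω (hproper i)
  choose j hj using hj
  let a := E ⟨0, by omega⟩ 0
  have ha : a ≠ 0 := Module.Basis.ne_zero _ 0
  obtain ⟨b, hab⟩ : ∃ b, ω a b = 1 := by
    obtain ⟨y, hy⟩ := DFunLike.ne_iff.1 (hω.form_ne_zero ha)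
    exact ⟨(ω a y)⁻¹ • y, by rw [map_smul, smul_eq_mul, inv_mul_cancel₀ hy]⟩
  refine infinite_orbits_of_transporters hV t hl P F hF a b (ω.flip b) (ω a) hab fun i s => ?_
  have hv : a + s • b ≠ 0 := fun h => by
    have := congrArg (ω.flip b) h
    simp [hab, alt.self_eq_zero] at this
  obtain ⟨g, hg, hgu⟩ := hω.exists_map_eq_of_isAlt alt ((E i).ne_zero (j i)) hv
  refine ⟨⟨g, hg⟩, ⟨_, hj i, hgu⟩, fun x hx => ?_⟩
  have h1 := hiso i _ (hj i) x hx
  rw [← (hω.mem_isometries_iff g).1 hg.2, hgu, map_add, map_smul, LinearMap.add_apply,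
    LinearMap.smul_apply, smul_eq_mul] at h1
  change ω a (g x) = s * ω (g x) b
  rw [← alt.neg_eq b]
  linear_combination h1

/-- A hyperbolic plane has only two isotropic lines, so `a` and `b` now span an isotropic plane,
with `α`, `β` given by isotropic vectors `a'`, `b'` dual to them. The containment in a kernel must
be imposed separately, through a second isotropic vector `f` orthogonal to `F`: the pair `(u, f)`
goes to `(a + s • b, b' - s • a')`. -/
theorem infinite_orbits_of_isSymm (hV : Module.rank ℂ V = Cardinal.aleph0) {t : ClassicalType V}
    {ω : LinearMap.BilinForm ℂ V} (hω : t.HasForm ω) (symm : ω.IsSymm) {l : ℕ} (hl : 4 ≤ l)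
    (P : Fin l → Subgroup t.indGroup) (hP : ∀ i, t.IsSplittingParabolic (P i))
    (hproper : ∀ i, P i ≠ ⊤) :
    Infinite (MulAction.orbitRel.Quotient t.indGroup (∀ i, t.indGroup ⧸ P i)) := by
  have hpair : ∀ i, ∃ F : Submodule ℂ V, (∀ p ∈ P i, ∀ x ∈ F, (p : V ≃ₗ[ℂ] V) x ∈ F) ∧
      ∃ u f, u ∈ F ∧ u ≠ 0 ∧ f ∉ Submodule.span ℂ {u} ∧ ω u u = 0 ∧ ω f f = 0 ∧
        ∀ x ∈ F, ω f x = 0 := by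
    intro i
    obtain ⟨E, hE, F, hF, ⟨j, hj⟩, hiso, hcoord⟩ :=
      (hP i).exists_isotropic_stable_subspace hω (hproper i)
    obtain ⟨σ, hinv, hfix, hσ⟩ := hω.hasInvolution E hE
    obtain ⟨k, hk, hσk⟩ := exists_notMem_apply_ne hfix {j, σ j}
    rw [Finset.mem_insert, Finset.mem_singleton, not_or] at hk
    have hself : ∀ m, σ m ≠ m → ω (E m) (E m) = 0 := fun m hm => by
      by_contra hne
      exact hm ((hσ m m).1 hne).symm
    -- Either `E k` lies in the isotropic space `F`, or the `k`-th coordinate vanishes on `F` and `E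
    -- (σ k)` is orthogonal to `F`.
    by_cases hF0 : ∃ x ∈ F, E.repr x k ≠ 0
    · obtain ⟨x, hx, hxk⟩ := hF0
      exact ⟨F, hF, E j, E k, hj, E.ne_zero j, basis_notMem_span_singleton E hk.1,
        hiso _ hj _ hj, hself k hσk, hiso _ (hcoord k x hx hxk)⟩
    · push Not at hF0
      refine ⟨F, hF, E j, E (σ k), hj, E.ne_zero j, basis_notMem_span_singleton E ?_,
        hiso _ hj _ hj, hself _ fun h => hσk (hinv.injective h), fun x hx => ?_⟩
      · exact fun h => hk.2 (by rw [← h, hinv])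
      · rw [form_basis_left hσ, hinv, hF0 x hx, mul_zero]
  choose F hF u f hu hu0 hfu huu hff hfF using hpair
  obtain ⟨E, -, hE, -⟩ := hP ⟨0, by omega⟩
  obtain ⟨σ, hinv, hfix, hσ⟩ := hω.hasInvolution E hE
  obtain ⟨i, -, hi⟩ := exists_notMem_apply_ne hfix ∅
  obtain ⟨k, hk, hk'⟩ := exists_notMem_apply_ne hfix {i, σ i}
  rw [Finset.mem_insert, Finset.mem_singleton, not_or] at hk
  have hzero : ∀ m n, n ≠ σ m → ω (E m) (E n) = 0 := fun m n h => by
    by_contra hne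
    exact h ((hσ m n).1 hne)
  have hσik : σ i ≠ σ k := fun h => hk.1 (hinv.injective h).symm
  have hki : i ≠ σ k := fun h => hk.2 (by rw [h, hinv])
  obtain ⟨a', haa', hab', ha'a', ha'b'⟩ : ∃ a', ω a' (E i) = 1 ∧ ω a' (E k) = 0 ∧
      ω a' a' = 0 ∧ ω a' (E (σ k)) = 0 := by
    have hne : ω (E (σ i)) (E i) ≠ 0 := (hσ _ _).2 (hinv i).symm
    refine ⟨(ω (E (σ i)) (E i))⁻¹ • E (σ i), ?_, ?_, ?_, ?_⟩
    · rw [map_smul, LinearMap.smul_apply, smul_eq_mul, inv_mul_cancel₀ hne]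
    · simp [hzero (σ i) k (by rw [hinv]; exact hk.1)]
    · simp [hzero (σ i) (σ i) (by rw [hinv]; exact hi)]
    · simp [hzero (σ i) (σ k) (by rw [hinv]; exact hki.symm)]
  obtain ⟨b', hba', hbb', hb'b', hb'a'⟩ : ∃ b', ω b' (E i) = 0 ∧ ω b' (E k) = 1 ∧
      ω b' b' = 0 ∧ ω a' b' = 0 := by
    have hne : ω (E (σ k)) (E k) ≠ 0 := (hσ _ _).2 (hinv k).symm
    refine ⟨(ω (E (σ k)) (E k))⁻¹ • E (σ k), ?_, ?_, ?_, ?_⟩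
    · simp [hzero (σ k) i (by rw [hinv]; exact Ne.symm hk.1)]
    · rw [map_smul, LinearMap.smul_apply, smul_eq_mul, inv_mul_cancel₀ hne]
    · simp [hzero (σ k) (σ k) (by rw [hinv]; exact hk')]
    · simp [ha'b']
  have hii := hzero i i hi.symm
  have hkk := hzero k k hk'.symm
  have hik := hzero i k hk.2
  refine infinite_orbits_of_transporters hV t hl P F hF (E i) (E k) (ω a') (ω b') haa'
    fun m s => ?_
  have hv0 : E i + s • E k ≠ 0 := fun h => by
    have := congrArg (ω a') h
    simp [haa', hab'] at this
  have hh : b' - s • a' ∉ Submodule.span ℂ {E i + s • E k} := by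
    rw [Submodule.mem_span_singleton]
    rintro ⟨c, hc⟩
    have := congrArg (ω.flip (E k)) hc
    simp [hbb', hab', hik, hkk] at this
  obtain ⟨g, hg, hgu, hgf⟩ := hω.exists_map_pair_eq symm (hu0 m) hv0 (hfu m) hh (huu m)
    (by rw [symm.eq, hfF m _ (hu m)]) (hff m)
    (by simp [hii, hkk, hik, symm.eq (E k) (E i)])
    (by simp [symm.eq (E i), symm.eq (E k), haa', hab', hba', hbb'])
    (by simp [ha'a', hb'b', hb'a', symm.eq b' a'])
  refine ⟨⟨g, hg⟩, ⟨_, hu m, hgu⟩, fun x hx => ?_⟩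
  have h1 := hfF m x hx
  rw [← (hω.mem_isometries_iff g).1 hg.2, hgf, map_sub, map_smul, LinearMap.sub_apply,
    LinearMap.smul_apply, smul_eq_mul, sub_eq_zero] at h1
  exact h1

end ClassicalType

theorem theorem3 {V : Type*} [AddCommGroup V] [Module ℂ V]
    (hV : Module.rank ℂ V = Cardinal.aleph0) (t : ClassicalType V)
    (l : ℕ) (hl : 4 ≤ l) (P : Fin l → Subgroup t.indGroup)
    (hP : ∀ i, t.IsSplittingParabolic (P i)) (hproper : ∀ i, P i ≠ ⊤) :
    Infinite (MulAction.orbitRel.Quotient t.indGroup (∀ i, t.indGroup ⧸ P i)) := by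
  cases t with
  | typeA Vs h1 h2 => exact ClassicalType.infinite_orbits_typeA hV Vs h1 h2 hl P hP hproper
  | typeBD ω symm nd =>
    exact ClassicalType.infinite_orbits_of_isSymm hV (ClassicalType.hasForm_typeBD ω symm nd) symm
      hl P hP hproper
  | typeC ω alt nd =>
    exact ClassicalType.infinite_orbits_of_isAlt hV (ClassicalType.hasForm_typeC ω alt nd) alt
      hl P hP hproper
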